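/- Let $B$ be a separable unital $C^*$-algebra (with $1\neq 0$) and let $\beta\in\mathrm{Aut}(B)$. Write $B_\infty=\ell^\infty(\mathbb{N},B)/c_0(\mathbb{N},B)$, regard $B$ as the subalgebra of (classes of) constant sequences, and let $\beta_\infty$ be the automorphism of $B_\infty$ induced by entrywise application of $\beta$. Say that $\beta$ is \emph{approximately representable} if there is a unitary $v\in (B_\infty)^{\beta_\infty}$, that is, a unitary $v\in B_\infty$ with $\beta_\infty(v)=v$, such that $\beta(b)=vbv^*$ for all $b\in B$. Let $B\rtimes_\beta\mathbb{Z}$ be the crossed product, with canonical unitary $u$ satisfying $ubu^*=\beta(b)$ for $b\in B$, and let $\widehat{\beta}\colon\mathbb{T}\to\mathrm{Aut}(B\rtimes_\beta\mathbb{Z})$ be the dual action, that is, the continuous action with $\widehat{\beta}_\zeta(b)=b$ for $b\in B$ and $\widehat{\beta}_\zeta(u)=\zeta u$ for $\zeta\in\mathbb{T}$. A continuous action $\alpha\colon\mathbb{T}\to\mathrm{Aut}(A)$ on a unital $C^*$-algebra $A$ has the \emph{Rokhlin property} if for every $\varepsilon>0$ and every finite subset $F\subseteq A$ there is a unitary $w\in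 A$ such that $\|\alpha_\zeta(w)-\zeta w\|<\varepsilon$ for all $\zeta\in\mathbb{T}$ and $\|wa-aw\|<\varepsilon$ for all $a\in F$. Then $\beta$ is approximately representable if and only if $\widehat{\beta}$ has the Rokhlin property. -/

import Mathlib

open Filter Topology
open scoped ENNReal

noncomputable section

/-! ### The sequence algebra `A_∞ = ℓ^∞(ℕ, A) / c₀(ℕ, A)` -/

section SequenceAlgebra

variable (A : Type*) [CStarAlgebra A] [Nontrivial A]

/-- `ℓ^∞(ℕ, A)`: bounded sequences with the pointwise operations. -/
abbrev BoundedSeq : Type _ := lp (fun _ : ℕ => A) ∞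

/-- `c₀(ℕ, A)`, as an ideal of `ℓ^∞(ℕ, A)`. -/
def nullSeqIdeal : Ideal (BoundedSeq A) where
  carrier := {a | Tendsto (fun n => ‖a n‖) atTop (𝓝 0)}
  add_mem' {a b} ha hb := by
    refine squeeze_zero (fun n => norm_nonneg _) (fun n => ?_) (by simpa using Tendsto.add ha hb)
    simpa using norm_add_le (a n) (b n)
  zero_mem' := by simp
  smul_mem' c a ha := by
    refine squeeze_zero (fun n => norm_nonneg _) (fun n => ?_)
      (by simpa using Tendsto.const_mul ‖c‖ ha)
    have h1 : ‖c n * a n‖ ≤ ‖c n‖ * ‖a n‖ := norm_mul_le _ _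
    have h2 : ‖c n‖ ≤ ‖c‖ := lp.norm_apply_le_norm (by simp) c n
    calc ‖(c • a) n‖ = ‖c n * a n‖ := by simp [smul_eq_mul, lp.infty_coeFn_mul]
      _ ≤ ‖c n‖ * ‖a n‖ := h1
      _ ≤ ‖c‖ * ‖a n‖ := mul_le_mul_of_nonneg_right h2 (norm_nonneg _)

variable {A} in
theorem mem_nullSeqIdeal {a : BoundedSeq A} :
    a ∈ nullSeqIdeal A ↔ Tendsto (fun n => ‖a n‖) atTop (𝓝 0) := Iff.rfl

instance nullSeqIdeal_isTwoSided : (nullSeqIdeal A).IsTwoSided where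
  mul_mem_of_left {a} c ha := by
    rw [mem_nullSeqIdeal] at ha ⊢
    refine squeeze_zero (fun n => norm_nonneg _) (fun n => ?_)
      (by simpa using Tendsto.mul_const ‖c‖ ha)
    have h2 : ‖c n‖ ≤ ‖c‖ := lp.norm_apply_le_norm (by simp) c n
    calc ‖(a * c) n‖ = ‖a n * c n‖ := by simp [lp.infty_coeFn_mul]
      _ ≤ ‖a n‖ * ‖c n‖ := norm_mul_le _ _
      _ ≤ ‖a n‖ * ‖c‖ := mul_le_mul_of_nonneg_left h2 (norm_nonneg _)

/-- `A_∞ = ℓ^∞(ℕ, A) / c₀(ℕ, A)`. -/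
abbrev SeqAlgebra : Type _ := BoundedSeq A ⧸ nullSeqIdeal A

/-- The class in `A_∞` of a bounded sequence. -/
abbrev SeqAlgebra.mk : BoundedSeq A →+* SeqAlgebra A := Ideal.Quotient.mk (nullSeqIdeal A)

theorem star_mem_nullSeqIdeal {a : BoundedSeq A} (ha : a ∈ nullSeqIdeal A) :
    star a ∈ nullSeqIdeal A := by
  rw [mem_nullSeqIdeal] at ha ⊢
  simpa [lp.star_apply] using ha

/-- The involution of `A_∞`, induced by the pointwise involution of sequences. -/
instance SeqAlgebra.instStarRing : StarRing (SeqAlgebra A) where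
  star := Quotient.map' star fun a b h => by
    rw [Submodule.quotientRel_def] at h ⊢
    simpa using star_mem_nullSeqIdeal A h
  star_involutive := by
    rintro ⟨a⟩
    exact congrArg (SeqAlgebra.mk A) (star_star a)
  star_mul := by
    rintro ⟨a⟩ ⟨b⟩
    exact congrArg (SeqAlgebra.mk A) (star_mul a b)
  star_add := by
    rintro ⟨a⟩ ⟨b⟩
    exact congrArg (SeqAlgebra.mk A) (star_add a b)

/-- The constant sequence with value `a`. -/
def constSeq (a : A) : BoundedSeq A :=
  ⟨fun _ => a, memℓp_infty ⟨‖a‖, by rintro _ ⟨n, rfl⟩; exact le_rfl⟩⟩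

/-- The identification of `A` with the constant sequences in `A_∞`. -/
def SeqAlgebra.const (a : A) : SeqAlgebra A := SeqAlgebra.mk A (constSeq A a)

variable {A}

/-- The entrywise application of an automorphism to a bounded sequence. -/
def mapSeq (φ : A ≃⋆ₐ[ℂ] A) : BoundedSeq A →+* BoundedSeq A where
  toFun a := ⟨fun n => φ (a n), memℓp_infty ⟨‖a‖, by
    rintro _ ⟨n, rfl⟩
    exact (NonUnitalStarAlgHom.norm_apply_le (φ : A →⋆ₙₐ[ℂ] A) (a n)).trans
      (lp.norm_apply_le_norm (by simp) a n)⟩⟩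
  map_one' := by ext n; simp [lp.infty_coeFn_one]
  map_mul' a b := by ext n; simp [lp.infty_coeFn_mul]
  map_zero' := by ext n; simp
  map_add' a b := by ext n; exact map_add φ (a n) (b n)

/-- The automorphism `φ_∞` of `A_∞` induced by an automorphism `φ` of `A`, acting entrywise on
representing sequences (recorded as a ring homomorphism). -/
def SeqAlgebra.map (φ : A ≃⋆ₐ[ℂ] A) : SeqAlgebra A →+* SeqAlgebra A :=
  Ideal.quotientMap (nullSeqIdeal A) (mapSeq φ) fun a ha => by
    rw [Ideal.mem_comap]
    rw [mem_nullSeqIdeal] at ha ⊢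
    exact squeeze_zero (fun n => norm_nonneg _)
      (fun n => NonUnitalStarAlgHom.norm_apply_le (φ : A →⋆ₙₐ[ℂ] A) (a n)) ha

/-- An automorphism `β` of a unital C⋆-algebra `B` (so that `M(B) = B`) is *approximately
representable* if it is implemented on `B` by a unitary `v` of `B_∞` that is fixed by `β_∞`, that is,
by an asymptotically `β`-fixed sequence. -/
def IsApproxRepresentable (β : A ≃⋆ₐ[ℂ] A) : Prop :=
  ∃ v ∈ unitary (SeqAlgebra A), SeqAlgebra.map β v = v ∧
    ∀ b : A, SeqAlgebra.const A (β b) = v * SeqAlgebra.const A b * star v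

end SequenceAlgebra

/-! ### Circle actions and the Rokhlin property -/

/-- A (point-norm continuous) action of the circle group on a C⋆-algebra. -/
structure CircleAction (A : Type*) [CStarAlgebra A] where
  /-- the underlying group homomorphism `𝕋 → Aut(A)` -/
  toHom : Circle →* (A ≃⋆ₐ[ℂ] A)
  continuous_apply : ∀ a : A, Continuous fun ζ => toHom ζ a

/-- The Rokhlin property of a circle action. -/
def CircleAction.HasRokhlinProperty {A : Type*} [CStarAlgebra A] (α : CircleAction A) : Prop :=
  ∀ ε : ℝ, 0 < ε → ∀ F : Finset A, ∃ u ∈ unitary A,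
    (∀ ζ : Circle, ‖α.toHom ζ u - (ζ : ℂ) • u‖ < ε) ∧ ∀ a ∈ F, ‖u * a - a * u‖ < ε

/-! ### The crossed product of a unital C⋆-algebra by an automorphism -/

section CrossedProduct

variable {B : Type*} [CStarAlgebra B]

/-- The group `ℤ`, written multiplicatively, tagged with the automorphism whose powers it acts by. -/
def ZAct (_β : B ≃⋆ₐ[ℂ] B) : Type := Multiplicative ℤ

variable (β : B ≃⋆ₐ[ℂ] B)

instance ZAct.instCommGroup : CommGroup (ZAct β) := inferInstanceAs (CommGroup (Multiplicative ℤ))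

variable {β} in
/-- The integer underlying an element of `ZAct β`. -/
def ZAct.toInt (n : ZAct β) : ℤ := Multiplicative.toAdd (show Multiplicative ℤ from n)

variable {β} in
@[simp] theorem ZAct.toInt_one : ZAct.toInt (1 : ZAct β) = 0 := rfl

variable {β} in
@[simp] theorem ZAct.toInt_mul (m n : ZAct β) : (m * n).toInt = m.toInt + n.toInt := rfl

variable {β} in
@[simp] theorem ZAct.toInt_inv (n : ZAct β) : (n⁻¹).toInt = -n.toInt := rfl

/-- `n` acts on `B` by `β ^ n`. -/
instance ZAct.instMulSemiringAction : MulSemiringAction (ZAct β) B where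
  smul n b := (β ^ n.toInt) b
  one_smul b := by change (β ^ (0 : ℤ)) b = b; simp
  mul_smul m n b := by
    change (β ^ (m.toInt + n.toInt)) b = (β ^ m.toInt) ((β ^ n.toInt) b)
    rw [zpow_add]; rfl
  smul_zero n := map_zero (β ^ n.toInt)
  smul_add n := map_add (β ^ n.toInt)
  smul_one n := map_one (β ^ n.toInt)
  smul_mul n := map_mul (β ^ n.toInt)

theorem ZAct.smul_def (n : ZAct β) (b : B) : n • b = (β ^ n.toInt) b := rfl

instance ZAct.instSMulCommClass : SMulCommClass (ZAct β) ℂ B where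
  smul_comm n z b := by simp only [ZAct.smul_def, map_smul]

theorem ZAct.smul_star (n : ZAct β) (b : B) : n • star b = star (n • b) := by
  simp only [ZAct.smul_def, map_star]

theorem ZAct.norm_smul (n : ZAct β) (b : B) : ‖n • b‖ = ‖b‖ :=
  NonUnitalStarAlgHom.norm_map ((β ^ n.toInt : B ≃⋆ₐ[ℂ] B) : B →⋆ₙₐ[ℂ] B)
    (β ^ n.toInt : B ≃⋆ₐ[ℂ] B).injective b

/-- The convolution algebra `C_c(ℤ, B, β)`: finite sums `∑ bₙ uⁿ`, where `single n b` stands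
for `b uⁿ`, with `(a uᵐ) (b uⁿ) = a βᵐ(b) uᵐ⁺ⁿ`. -/
def ConvAlg : Type _ := SkewMonoidAlgebra B (ZAct β)

namespace ConvAlg

open SkewMonoidAlgebra

instance instRing : Ring (ConvAlg β) := inferInstanceAs (Ring (SkewMonoidAlgebra B (ZAct β)))

instance instAlgebra : Algebra ℂ (ConvAlg β) :=
  inferInstanceAs (Algebra ℂ (SkewMonoidAlgebra B (ZAct β)))

/-- The element `b uⁿ`. -/
def mono (n : ZAct β) (b : B) : ConvAlg β := SkewMonoidAlgebra.single n b

variable {β} in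
@[elab_as_elim]
theorem induct {p : ConvAlg β → Prop} (f : ConvAlg β) (zero : p 0)
    (mono : ∀ n b, p (mono β n b)) (add : ∀ f g, p f → p g → p (f + g)) : p f :=
  SkewMonoidAlgebra.induction_on f zero mono add

theorem mono_mul (m n : ZAct β) (a b : B) :
    mono β m a * mono β n b = mono β (m * n) (a * m • b) :=
  SkewMonoidAlgebra.single_mul_single

theorem mono_add (n : ZAct β) (a b : B) : mono β n (a + b) = mono β n a + mono β n b :=
  SkewMonoidAlgebra.single_add n a b

theorem mono_zero (n : ZAct β) : mono β n 0 = 0 := SkewMonoidAlgebra.single_zero n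

theorem smul_mono (z : ℂ) (n : ZAct β) (b : B) : z • mono β n b = mono β n (z • b) :=
  SkewMonoidAlgebra.smul_single z n b

theorem one_def : (1 : ConvAlg β) = mono β 1 1 := rfl

variable {β} in
/-- Additive extension of a family of additive maps on the coefficients. -/
def liftAdd {N : Type*} [AddCommMonoid N] (h : ZAct β → B →+ N) : ConvAlg β →+ N where
  toFun f := SkewMonoidAlgebra.sum f fun n b => h n b
  map_zero' := SkewMonoidAlgebra.sum_zero_index
  map_add' f g := SkewMonoidAlgebra.sum_add_index' (by simp) (by simp)

variable {β} in
theorem liftAdd_mono {N : Type*} [AddCommMonoid N] (h : ZAct β → B →+ N) (n : ZAct β) (b : B) :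
    liftAdd h (mono β n b) = h n b :=
  SkewMonoidAlgebra.sum_single_index (by simp)

/-- The involution of `C_c(ℤ, B, β)`, as an additive map: `(b uⁿ)* = β⁻ⁿ(b*) u⁻ⁿ`. -/
def starHom : ConvAlg β →+ ConvAlg β :=
  liftAdd fun n =>
    { toFun := fun b => mono β n⁻¹ (n⁻¹ • star b)
      map_zero' := by simp [mono_zero]
      map_add' := fun a b => by simp [mono_add] }

theorem starHom_mono (n : ZAct β) (b : B) :
    starHom β (mono β n b) = mono β n⁻¹ (n⁻¹ • star b) := liftAdd_mono _ n b

instance instStarRing : StarRing (ConvAlg β) where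
  star := starHom β
  star_involutive f := by
    induction f using induct with
    | zero => simp
    | mono n b =>
      rw [starHom_mono, starHom_mono, inv_inv, ← ZAct.smul_star, star_star, smul_inv_smul]
    | add f g hf hg => rw [map_add, map_add, hf, hg]
  star_mul f g := by
    change starHom β (f * g) = starHom β g * starHom β f
    induction f using induct with
    | zero => simp
    | add f₁ f₂ h₁ h₂ => rw [add_mul, map_add, h₁, h₂, map_add, mul_add]
    | mono m a =>
      induction g using induct with
      | zero => simp
      | add g₁ g₂ h₁ h₂ => rw [mul_add, map_add, h₁, h₂, map_add, add_mul]
      | mono n b =>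
        rw [mono_mul, starHom_mono, starHom_mono, starHom_mono, mono_mul, mul_inv_rev, star_mul,
          ← ZAct.smul_star, smul_mul', smul_smul, smul_smul, inv_mul_cancel_right]
  star_add f g := map_add (starHom β) f g

theorem star_mono (n : ZAct β) (b : B) :
    star (mono β n b) = mono β n⁻¹ (n⁻¹ • star b) := starHom_mono β n b

instance instStarModule : StarModule ℂ (ConvAlg β) where
  star_smul z f := by
    induction f using induct with
    | zero => simp
    | mono n b => rw [smul_mono, star_mono, star_mono, smul_mono, star_smul, smul_comm]
    | add f g hf hg => rw [smul_add, star_add, hf, hg, star_add, smul_add]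

variable {β} in
/-- The `ℓ¹`-norm `∑ ‖bₙ‖` of `∑ bₙ uⁿ`. -/
def l1Norm (f : ConvAlg β) : ℝ := SkewMonoidAlgebra.sum f fun _ b => ‖b‖

variable {β} in
/-- A seminorm `p` on `C_c(ℤ, B, β)` is a C⋆-seminorm (dominated by the `ℓ¹`-norm) if it is
submultiplicative and satisfies the C⋆-identity. These are exactly the seminorms
`f ↦ ‖∑ π(bₙ) Uⁿ‖` coming from covariant representations `(π, U)` of `(B, β)`. -/
structure IsCStarSeminorm (p : Seminorm ℂ (ConvAlg β)) : Prop where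
  mul_le : ∀ f g, p (f * g) ≤ p f * p g
  star_mul_self : ∀ f, p (star f * f) = p f * p f
  le_l1Norm : ∀ f, p f ≤ l1Norm f

/-- The C⋆-seminorms on `C_c(ℤ, B, β)`. -/
def CStarSeminorm : Type _ := {p : Seminorm ℂ (ConvAlg β) // IsCStarSeminorm p}

variable {β} in
theorem l1Norm_nonneg (f : ConvAlg β) : 0 ≤ l1Norm f := Finset.sum_nonneg fun _ _ => norm_nonneg _

instance : Nonempty (CStarSeminorm β) := ⟨⟨0, by simp, by simp, by simpa using l1Norm_nonneg⟩⟩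

variable {β} in
/-- The universal (maximal) C⋆-norm on `C_c(ℤ, B, β)`: the supremum of all C⋆-seminorms. -/
def maxNorm (f : ConvAlg β) : ℝ := ⨆ p : CStarSeminorm β, p.1 f

variable {β} in
theorem le_maxNorm (p : CStarSeminorm β) (f : ConvAlg β) : p.1 f ≤ maxNorm f :=
  le_ciSup (f := fun p : CStarSeminorm β => p.1 f)
    ⟨l1Norm f, by rintro _ ⟨q, rfl⟩; exact q.2.le_l1Norm f⟩ p

variable {β} in
theorem maxNorm_le {f : ConvAlg β} {r : ℝ} (h : ∀ p : CStarSeminorm β, p.1 f ≤ r) :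
    maxNorm f ≤ r := ciSup_le h

variable {β} in
theorem maxNorm_nonneg (f : ConvAlg β) : 0 ≤ maxNorm f :=
  (apply_nonneg (Classical.arbitrary (CStarSeminorm β)).1 f).trans (le_maxNorm _ f)

variable {β} in
theorem maxNorm_le_l1Norm (f : ConvAlg β) : maxNorm f ≤ l1Norm f :=
  maxNorm_le fun p => p.2.le_l1Norm f

/-- The universal norm, as a ring seminorm. -/
def maxRingSeminorm : RingSeminorm (ConvAlg β) where
  toFun := maxNorm
  map_zero' := le_antisymm (maxNorm_le fun p => by simp) (maxNorm_nonneg _)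
  add_le' f g := maxNorm_le fun p =>
    (map_add_le_add p.1 f g).trans (add_le_add (le_maxNorm p f) (le_maxNorm p g))
  neg' f := by simp [maxNorm]
  mul_le' f g := maxNorm_le fun p => (p.2.mul_le f g).trans
    (mul_le_mul (le_maxNorm p f) (le_maxNorm p g) (apply_nonneg _ _) (maxNorm_nonneg f))

instance instSeminormedRing : SeminormedRing (ConvAlg β) := (maxRingSeminorm β).toSeminormedRing

theorem norm_def (f : ConvAlg β) : ‖f‖ = maxNorm f := rfl

instance instNormedAlgebra : NormedAlgebra ℂ (ConvAlg β) where
  norm_smul_le z f := maxNorm_le fun p => by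
    rw [map_smul_eq_mul]
    exact mul_le_mul_of_nonneg_left (le_maxNorm p f) (norm_nonneg z)

theorem norm_mul_self_le_star_mul (f : ConvAlg β) : ‖f‖ * ‖f‖ ≤ ‖star f * f‖ := by
  rw [← sq, ← Real.le_sqrt (norm_nonneg _) (norm_nonneg _), norm_def, norm_def]
  refine maxNorm_le fun p => Real.le_sqrt_of_sq_le ?_
  rw [sq, ← p.2.star_mul_self]
  exact le_maxNorm p _

instance instNormedStarGroup : NormedStarGroup (ConvAlg β) where
  norm_star_le f := by
    have h := (norm_mul_self_le_star_mul β (star f)).trans (norm_mul_le _ _)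
    rw [star_star] at h
    by_contra! hlt
    have h0 : 0 < ‖star f‖ := (norm_nonneg f).trans_lt hlt
    exact absurd h (not_le.mpr (mul_lt_mul_of_pos_right hlt h0))

end ConvAlg

/-- The crossed product `B ⋊_β ℤ`: the completion of `C_c(ℤ, B, β)` in the universal C⋆-norm. -/
def CrossedProduct : Type _ := UniformSpace.Completion (ConvAlg β)

namespace CrossedProduct

open UniformSpace

instance instNormedRing : NormedRing (CrossedProduct β) :=
  inferInstanceAs (NormedRing (Completion (ConvAlg β)))

instance instCompleteSpace : CompleteSpace (CrossedProduct β) :=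
  inferInstanceAs (CompleteSpace (Completion (ConvAlg β)))

instance instAlgebra : Algebra ℂ (CrossedProduct β) :=
  inferInstanceAs (Algebra ℂ (Completion (ConvAlg β)))

variable {β} in
/-- The canonical map `C_c(ℤ, B, β) → B ⋊_β ℤ`. -/
def of (f : ConvAlg β) : CrossedProduct β := (f : Completion (ConvAlg β))

theorem of_add (f g : ConvAlg β) : of (f + g) = of f + of g := Completion.coe_add f g

theorem of_mul (f g : ConvAlg β) : of (f * g) = of f * of g := Completion.coe_mul f g

theorem of_smul (z : ℂ) (f : ConvAlg β) : of (z • f) = z • of f := Completion.coe_smul z f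

theorem norm_of (f : ConvAlg β) : ‖of f‖ = ‖f‖ := Completion.norm_coe f

variable {β} in
@[elab_as_elim]
theorem induct {p : CrossedProduct β → Prop} (x : CrossedProduct β) (closed : IsClosed {x | p x})
    (of : ∀ f, p (of f)) : p x :=
  Completion.induction_on x closed of

variable {β} in
@[elab_as_elim]
theorem induct₂ {p : CrossedProduct β → CrossedProduct β → Prop} (x y : CrossedProduct β)
    (closed : IsClosed {x : CrossedProduct β × CrossedProduct β | p x.1 x.2})
    (of : ∀ f g, p (of f) (of g)) : p x y :=
  Completion.induction_on₂ x y closed of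

instance instNormedAlgebra : NormedAlgebra ℂ (CrossedProduct β) where
  norm_smul_le z x := by
    induction x using induct with
    | closed =>
      exact isClosed_le (f := fun x : Completion (ConvAlg β) => ‖z • x‖)
        (continuous_norm.comp (continuous_const_smul z)) (continuous_const.mul continuous_norm)
    | of f => rw [← of_smul, norm_of, norm_of]; exact norm_smul_le z f

instance instStar : Star (CrossedProduct β) where
  star := Completion.map (star : ConvAlg β → ConvAlg β)

theorem star_of (f : ConvAlg β) : star (of f) = of (star f) :=
  Completion.map_coe (star_isometry (E := ConvAlg β)).uniformContinuous f

instance instContinuousStar : ContinuousStar (CrossedProduct β) where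
  continuous_star := Completion.continuous_map

instance instStarRing : StarRing (CrossedProduct β) where
  star_involutive x := by
    induction x using induct with
    | closed => exact isClosed_eq (continuous_star.comp continuous_star) continuous_id
    | of f => rw [star_of, star_of, star_star]
  star_mul x y := by
    induction x, y using induct₂ with
    | closed =>
      exact isClosed_eq (continuous_star.comp continuous_mul)
        ((continuous_star.comp continuous_snd).mul (continuous_star.comp continuous_fst))
    | of f g => rw [← of_mul, star_of, star_mul, of_mul, star_of, star_of]
  star_add x y := by
    induction x, y using induct₂ with
    | closed => exact isClosed_eq (by fun_prop) (by fun_prop)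
    | of f g => rw [← of_add, star_of, star_add, of_add, star_of, star_of]

instance instStarModule : StarModule ℂ (CrossedProduct β) where
  star_smul z x := by
    induction x using induct with
    | closed =>
      exact isClosed_eq (continuous_star.comp (continuous_const_smul z))
        ((continuous_const_smul (star z)).comp continuous_star)
    | of f => rw [← of_smul, star_of, star_smul, of_smul, star_of]

instance instCStarRing : CStarRing (CrossedProduct β) where
  norm_mul_self_le x := by
    induction x using induct with
    | closed => exact isClosed_le (by fun_prop) (by fun_prop)
    | of f =>
      rw [star_of, ← of_mul, norm_of, norm_of]
      exact ConvAlg.norm_mul_self_le_star_mul β f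

instance instCStarAlgebra : CStarAlgebra (CrossedProduct β) where

end CrossedProduct

/-! ### The dual action -/

namespace ConvAlg

/-- The map `∑ bₙ uⁿ ↦ ∑ ζⁿ bₙ uⁿ` on `C_c(ℤ, B, β)`, as an additive map. -/
def gaugeHom (ζ : Circle) : ConvAlg β →+ ConvAlg β :=
  liftAdd fun n =>
    { toFun := fun b => mono β n (((ζ ^ n.toInt : Circle) : ℂ) • b)
      map_zero' := by simp [mono_zero]
      map_add' := fun a b => by simp [mono_add] }

theorem gaugeHom_mono (ζ : Circle) (n : ZAct β) (b : B) :
    gaugeHom β ζ (mono β n b) = mono β n (((ζ ^ n.toInt : Circle) : ℂ) • b) := liftAdd_mono _ n b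

theorem gaugeHom_one_apply (f : ConvAlg β) : gaugeHom β 1 f = f := by
  induction f using induct with
  | zero => simp
  | mono n b => rw [gaugeHom_mono]; simp
  | add f g hf hg => rw [map_add, hf, hg]

theorem gaugeHom_gaugeHom (ζ ξ : Circle) (f : ConvAlg β) :
    gaugeHom β ζ (gaugeHom β ξ f) = gaugeHom β (ζ * ξ) f := by
  induction f using induct with
  | zero => simp
  | mono n b => rw [gaugeHom_mono, gaugeHom_mono, gaugeHom_mono, smul_smul, mul_zpow, Circle.coe_mul]
  | add f g hf hg => rw [map_add, map_add, map_add, hf, hg]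

theorem gaugeHom_mul (ζ : Circle) (f g : ConvAlg β) :
    gaugeHom β ζ (f * g) = gaugeHom β ζ f * gaugeHom β ζ g := by
  induction f using induct with
  | zero => simp
  | add f₁ f₂ h₁ h₂ => rw [add_mul, map_add, h₁, h₂, map_add, add_mul]
  | mono m a =>
    induction g using induct with
    | zero => simp
    | add g₁ g₂ h₁ h₂ => rw [mul_add, map_add, h₁, h₂, map_add, mul_add]
    | mono n b =>
      rw [mono_mul, gaugeHom_mono, gaugeHom_mono, gaugeHom_mono, mono_mul, smul_comm m,
        smul_mul_smul_comm, ZAct.toInt_mul, zpow_add, Circle.coe_mul]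

theorem gaugeHom_star (ζ : Circle) (f : ConvAlg β) :
    gaugeHom β ζ (star f) = star (gaugeHom β ζ f) := by
  induction f using induct with
  | zero => simp
  | mono n b =>
    rw [star_mono, gaugeHom_mono, gaugeHom_mono, star_mono, star_smul, smul_comm n⁻¹,
      ZAct.toInt_inv, zpow_neg, Circle.coe_inv_eq_conj]
    rfl
  | add f g hf hg => rw [star_add, map_add, hf, hg, map_add, star_add]

theorem gaugeHom_smul (ζ : Circle) (z : ℂ) (f : ConvAlg β) :
    gaugeHom β ζ (z • f) = z • gaugeHom β ζ f := by
  induction f using induct with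
  | zero => simp
  | mono n b => rw [smul_mono, gaugeHom_mono, gaugeHom_mono, smul_mono, smul_comm]
  | add f g hf hg => rw [smul_add, map_add, hf, hg, map_add, smul_add]

theorem l1Norm_gaugeHom_le (ζ : Circle) (f : ConvAlg β) : l1Norm (gaugeHom β ζ f) ≤ l1Norm f := by
  have hcoeff : ∀ n, SkewMonoidAlgebra.coeff (gaugeHom β ζ f) n =
      ((ζ ^ n.toInt : Circle) : ℂ) • SkewMonoidAlgebra.coeff f n := fun n => by
    classical
    induction f using induct with
    | zero =>
      rw [map_zero]
      exact (smul_zero _).symm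
    | mono m b =>
      rw [gaugeHom_mono]
      simp only [mono, SkewMonoidAlgebra.coeff_single, Finsupp.single_apply]
      split_ifs with h
      · rw [h]
      · rw [smul_zero]
    | add f g hf hg =>
      rw [map_add]
      have hadd : ∀ f g : ConvAlg β, SkewMonoidAlgebra.coeff (f + g) n =
          SkewMonoidAlgebra.coeff f n + SkewMonoidAlgebra.coeff g n := fun f g =>
        DFunLike.congr_fun (SkewMonoidAlgebra.coeff_add f g) n
      rw [hadd, hadd, hf, hg, smul_add]
  have hsub : (SkewMonoidAlgebra.coeff (gaugeHom β ζ f)).support ⊆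
      (SkewMonoidAlgebra.coeff f).support := fun n hn => by
    rw [Finsupp.mem_support_iff] at hn ⊢
    intro h0
    exact hn (by rw [hcoeff, h0, smul_zero])
  calc l1Norm (gaugeHom β ζ f)
      ≤ ∑ n ∈ (SkewMonoidAlgebra.coeff f).support,
          ‖SkewMonoidAlgebra.coeff (gaugeHom β ζ f) n‖ :=
        Finset.sum_le_sum_of_subset_of_nonneg hsub fun _ _ _ => norm_nonneg _
    _ = l1Norm f := Finset.sum_congr rfl fun n _ => by
        rw [hcoeff, norm_smul, Circle.norm_coe, one_mul]

theorem norm_gaugeHom_le (ζ : Circle) (f : ConvAlg β) : ‖gaugeHom β ζ f‖ ≤ ‖f‖ :=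
  maxNorm_le fun p => by
    let L : ConvAlg β →ₗ[ℂ] ConvAlg β :=
      { toFun := gaugeHom β ζ, map_add' := map_add _, map_smul' := gaugeHom_smul β ζ }
    refine le_maxNorm (⟨p.1.comp L, ?_, ?_, ?_⟩ : CStarSeminorm β) f
    · intro f g
      change p.1 (gaugeHom β ζ (f * g)) ≤ p.1 (gaugeHom β ζ f) * p.1 (gaugeHom β ζ g)
      rw [gaugeHom_mul]
      exact p.2.mul_le _ _
    · intro f
      change p.1 (gaugeHom β ζ (star f * f)) = p.1 (gaugeHom β ζ f) * p.1 (gaugeHom β ζ f)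
      rw [gaugeHom_mul, gaugeHom_star]
      exact p.2.star_mul_self _
    · exact fun f => (p.2.le_l1Norm _).trans (l1Norm_gaugeHom_le β ζ f)

theorem norm_mono_le (n : ZAct β) (b : B) : ‖mono β n b‖ ≤ ‖b‖ :=
  (maxNorm_le_l1Norm _).trans_eq (SkewMonoidAlgebra.sum_single_index (by simp))

theorem continuous_mono (n : ZAct β) : Continuous (mono β n) :=
  AddMonoidHomClass.continuous_of_bound
    ({ toFun := mono β n, map_zero' := mono_zero β n, map_add' := mono_add β n } :
      B →+ ConvAlg β) 1 fun b => by simpa using norm_mono_le β n b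

theorem continuous_gaugeHom (ζ : Circle) : Continuous (gaugeHom β ζ) :=
  AddMonoidHomClass.continuous_of_bound (gaugeHom β ζ) 1 fun f => by
    simpa using norm_gaugeHom_le β ζ f

theorem continuous_gaugeHom_apply (f : ConvAlg β) : Continuous fun ζ => gaugeHom β ζ f := by
  induction f using induct with
  | zero => simpa using continuous_const
  | mono n b =>
    simp only [gaugeHom_mono]
    refine (continuous_mono β n).comp (Continuous.smul ?_ continuous_const)
    exact continuous_subtype_val.comp (continuous_zpow (G := Circle) n.toInt)
  | add f g hf hg => simp only [map_add]; exact hf.add hg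

end ConvAlg

namespace CrossedProduct

open UniformSpace

/-- The extension of `∑ bₙ uⁿ ↦ ∑ ζⁿ bₙ uⁿ` to `B ⋊_β ℤ`. -/
def gauge (ζ : Circle) : CrossedProduct β → CrossedProduct β :=
  Completion.map (ConvAlg.gaugeHom β ζ)

theorem gauge_of (ζ : Circle) (f : ConvAlg β) :
    gauge β ζ (of f) = of (ConvAlg.gaugeHom β ζ f) :=
  Completion.map_coe
    (uniformContinuous_addMonoidHom_of_continuous (ConvAlg.continuous_gaugeHom β ζ)) f

theorem continuous_gauge (ζ : Circle) : Continuous (gauge β ζ) := Completion.continuous_map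

theorem gauge_one_apply (x : CrossedProduct β) : gauge β 1 x = x := by
  induction x using induct with
  | closed => exact isClosed_eq (continuous_gauge β 1) continuous_id
  | of f => rw [gauge_of, ConvAlg.gaugeHom_one_apply]

theorem gauge_gauge (ζ ξ : Circle) (x : CrossedProduct β) :
    gauge β ζ (gauge β ξ x) = gauge β (ζ * ξ) x := by
  induction x using induct with
  | closed =>
    exact isClosed_eq ((continuous_gauge β ζ).comp (continuous_gauge β ξ)) (continuous_gauge β _)
  | of f => rw [gauge_of, gauge_of, gauge_of, ConvAlg.gaugeHom_gaugeHom]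

/-- The automorphism `β̂_ζ` of `B ⋊_β ℤ`, with `β̂_ζ(b uⁿ) = ζⁿ b uⁿ`. -/
def gaugeAut (ζ : Circle) : CrossedProduct β ≃⋆ₐ[ℂ] CrossedProduct β where
  toFun := gauge β ζ
  invFun := gauge β ζ⁻¹
  left_inv x := by rw [gauge_gauge, inv_mul_cancel, gauge_one_apply]
  right_inv x := by rw [gauge_gauge, mul_inv_cancel, gauge_one_apply]
  map_mul' x y := by
    have h := continuous_gauge β ζ
    induction x, y using induct₂ with
    | closed =>
      exact isClosed_eq (h.comp continuous_mul)
        ((h.comp continuous_fst).mul (h.comp continuous_snd))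
    | of f g => rw [← of_mul, gauge_of, ConvAlg.gaugeHom_mul, of_mul, gauge_of, gauge_of]
  map_add' x y := by
    have h := continuous_gauge β ζ
    induction x, y using induct₂ with
    | closed => exact isClosed_eq (by fun_prop) (by fun_prop)
    | of f g => rw [← of_add, gauge_of, map_add, of_add, gauge_of, gauge_of]
  map_star' x := by
    have h := continuous_gauge β ζ
    induction x using induct with
    | closed => exact isClosed_eq (by fun_prop) (by fun_prop)
    | of f => rw [star_of, gauge_of, ConvAlg.gaugeHom_star, gauge_of, star_of]
  map_smul' z x := by
    have h := continuous_gauge β ζ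
    induction x using induct with
    | closed =>
      exact isClosed_eq (h.comp (continuous_const_smul z)) ((continuous_const_smul z).comp h)
    | of f => rw [← of_smul, gauge_of, ConvAlg.gaugeHom_smul, gauge_of, of_smul]

theorem continuous_gauge_apply (x : CrossedProduct β) : Continuous fun ζ => gauge β ζ x := by
  have hn : ∀ (ζ : Circle) (y : CrossedProduct β), ‖gauge β ζ y‖ = ‖y‖ := fun ζ y =>
    NonUnitalStarAlgHom.norm_map (gaugeAut β ζ : CrossedProduct β →⋆ₙₐ[ℂ] CrossedProduct β)
      (gaugeAut β ζ).injective y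
  refine continuous_of_uniform_approx_of_continuous fun U hU => ?_
  obtain ⟨ε, hε, hU⟩ := Metric.mem_uniformity_dist.mp hU
  obtain ⟨f, hf⟩ : ∃ f : ConvAlg β, dist x (of f) < ε :=
    (Completion.denseRange_coe (α := ConvAlg β)).exists_dist_lt x hε
  refine ⟨fun ζ => gauge β ζ (of f), ?_, fun ζ => hU ?_⟩
  · simp only [gauge_of]
    exact (Completion.continuous_coe (ConvAlg β)).comp (ConvAlg.continuous_gaugeHom_apply β f)
  · have h : gauge β ζ x - gauge β ζ (of f) = gauge β ζ (x - of f) :=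
      (map_sub (gaugeAut β ζ) x (of f)).symm
    rw [dist_eq_norm, h, hn, ← dist_eq_norm]
    exact hf

end CrossedProduct

/-- The dual action `β̂` of the circle on `B ⋊_β ℤ`, with `β̂_ζ(b uⁿ) = ζⁿ b uⁿ`. -/
def dualAction : CircleAction (CrossedProduct β) where
  toHom :=
    { toFun := CrossedProduct.gaugeAut β
      map_one' := StarAlgEquiv.ext (CrossedProduct.gauge_one_apply β)
      map_mul' := fun ζ ξ =>
        StarAlgEquiv.ext fun x => (CrossedProduct.gauge_gauge β ζ ξ x).symm }
  continuous_apply := CrossedProduct.continuous_gauge_apply β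

end CrossedProduct

/-!
Unitaries `v` of `B` correspond to unitaries `w = v* u` of `B ⋊_β ℤ`, all of which satisfy
`β̂_ζ(w) = ζ w`. Since `w b w* = v* β(b) v` and `w u w* = v* β(v) u`, a sequence `vₙ` is
asymptotically `β`-fixed and implements `β` if and only if `wₙ = vₙ* u` commutes asymptotically with
the generators of `B ⋊_β ℤ`. This turns approximate representability into the Rokhlin property.

Conversely, Rokhlin unitaries `wₙ` are only approximately equivariant, so that `u wₙ*` is only
approximately fixed by `β̂`. Averaging over the circle moves it slightly into the fixed point
algebra, which is `B`, and polar decomposition replaces the result by a unitary `vₙ` of `B` without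
affecting the limit. For the pullback to `B` one needs `B → B ⋊_β ℤ` to be isometric: the universal
norm dominates the norm of the regular representation, which is faithful on `C_c(ℤ, B, β)`.
-/

/-! ### Asymptotically unitary sequences -/

section AsymptoticallyUnitary

variable {A : Type*} [CStarAlgebra A]

attribute [local instance] CStarAlgebra.spectralOrder CStarAlgebra.spectralOrderedRing

theorem norm_sqrt_sub_one_le {a : A} (ha : 0 ≤ a) : ‖CFC.sqrt a - 1‖ ≤ ‖a - 1‖ := by
  have h_sqrt : CFC.sqrt a - 1 = cfc (fun t : ℝ => √t - 1) a := by
    rw [CFC.sqrt_eq_real_sqrt a, cfcₙ_eq_cfc, cfc_sub _ _ a, cfc_const_one ℝ a]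
  have h_id : a - 1 = cfc (fun t : ℝ => t - 1) a := by
    rw [cfc_sub _ _ a, cfc_id' ℝ a, cfc_const_one ℝ a]
  rw [h_sqrt]
  refine norm_cfc_le (norm_nonneg _) fun t ht => ?_
  calc ‖√t - 1‖ ≤ ‖√t - 1‖ * ‖√t + 1‖ := le_mul_of_one_le_right (norm_nonneg _) <| by
        rw [Real.norm_of_nonneg (by positivity)]
        exact le_add_of_nonneg_left (Real.sqrt_nonneg t)
    _ = ‖t - 1‖ := by
        rw [← norm_mul, mul_comm, ← mul_self_sub_one,
          Real.mul_self_sqrt (spectrum_nonneg_of_nonneg ha ht)]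
    _ ≤ ‖a - 1‖ := h_id ▸ norm_apply_le_norm_cfc (fun t : ℝ => t - 1) a ht

theorem exists_unitary_norm_sub_le {a : A} (ha : IsUnit a) :
    ∃ w : unitary A, ‖a - w‖ ≤ ‖star a * a - 1‖ := by
  have h_nonneg : 0 ≤ star a * a := star_mul_self_nonneg a
  obtain ⟨s, hs⟩ : IsUnit (CFC.sqrt (star a * a)) :=
    (CFC.isUnit_sqrt_iff _).mpr (ha.star.mul ha)
  have hs_star : star s = s :=
    Units.ext (hs ▸ CFC.sqrt_nonneg (star a * a) : 0 ≤ (s : A)).isSelfAdjoint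
  have hs_sq : star a * a = s * s := by rw [hs, CFC.sqrt_mul_sqrt_self _]
  have hw : a * ↑s⁻¹ ∈ unitary A := (ha.mul s⁻¹.isUnit).mem_unitary_of_star_mul_self <| by
    rw [star_mul, ← Units.coe_star_inv, hs_star, mul_assoc, ← mul_assoc (star a), hs_sq]
    simp [mul_assoc]
  refine ⟨⟨a * ↑s⁻¹, hw⟩, ?_⟩
  calc ‖a - a * ↑s⁻¹‖ = ‖a * ↑s⁻¹ * (s - 1)‖ := by simp [mul_sub, mul_assoc]
    _ = ‖(s : A) - 1‖ := CStarRing.norm_mem_unitary_mul _ hw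
    _ ≤ ‖star a * a - 1‖ := hs ▸ norm_sqrt_sub_one_le h_nonneg

theorem isUnit_of_isUnit_mul_of_isUnit_mul {M : Type*} [Monoid M] {a b : M} (hab : IsUnit (a * b))
    (hba : IsUnit (b * a)) : IsUnit a := by
  obtain ⟨c, hc⟩ := hab.exists_right_inv
  obtain ⟨d, hd⟩ := hba.exists_left_inv
  exact isUnit_iff_exists_and_exists.mpr
    ⟨⟨b * c, by rwa [← mul_assoc]⟩, ⟨d * b, by rwa [mul_assoc]⟩⟩

theorem exists_unitary_tendsto_sub {ι : Type*} {l : Filter ι} {a : ι → A}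
    (h_star_mul : Tendsto (fun i => star (a i) * a i) l (𝓝 1))
    (h_mul_star : Tendsto (fun i => a i * star (a i)) l (𝓝 1)) :
    ∃ w : ι → unitary A, Tendsto (fun i => a i - w i) l (𝓝 0) := by
  have h : ∀ i, ∃ w : unitary A, IsUnit (a i) → ‖a i - w‖ ≤ ‖star (a i) * a i - 1‖ := fun i => by
    by_cases hi : IsUnit (a i)
    · exact (exists_unitary_norm_sub_le hi).imp fun _ hw _ => hw
    · exact ⟨1, fun h => absurd h hi⟩
  choose w hw using h
  refine ⟨w, squeeze_zero_norm' ?_ (tendsto_iff_norm_sub_tendsto_zero.mp h_star_mul)⟩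
  filter_upwards [h_star_mul.eventually (Units.nhds 1), h_mul_star.eventually (Units.nhds 1)]
    with i h_unit h_unit'
  exact hw i (isUnit_of_isUnit_mul_of_isUnit_mul h_unit' h_unit)

theorem tendsto_star_mul_self_of_tendsto_sub_unitary {ι : Type*} {l : Filter ι} {a : ι → A}
    {w : ι → unitary A} (h : Tendsto (fun i => a i - w i) l (𝓝 0)) :
    Tendsto (fun i => star (a i) * a i) l (𝓝 1) := by
  have h_mul : Tendsto (fun i => star (w i : A) * a i) l (𝓝 1) := by
    rw [tendsto_iff_norm_sub_tendsto_zero]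
    refine (tendsto_zero_iff_norm_tendsto_zero.mp h).congr fun i => ?_
    rw [← CStarRing.norm_coe_unitary_mul (star (w i)), Unitary.coe_star, mul_sub,
      Unitary.coe_star_mul_self]
  have h_star_mul := h_mul.star.mul h_mul
  rw [star_one, one_mul] at h_star_mul
  refine h_star_mul.congr fun i => ?_
  rw [star_mul, star_star, mul_assoc, ← mul_assoc (w i : A),
    Unitary.mul_star_self_of_mem (w i).prop, one_mul]

theorem exists_unitary_tendsto_map_sub {ι B : Type*} [CStarAlgebra B] {l : Filter ι}
    {f : B →⋆ₐ[ℂ] A} (hf : Isometry f) {b : ι → B} {w : ι → unitary A}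
    (h : Tendsto (fun i => f (b i) - w i) l (𝓝 0)) :
    ∃ v : ι → unitary B, Tendsto (fun i => f (v i) - w i) l (𝓝 0) := by
  have h_star : Tendsto (fun i => star (f (b i)) - (star (w i) : unitary A)) l (𝓝 0) := by
    simpa only [star_sub, star_zero, Unitary.coe_star] using h.star
  have h_star_mul : Tendsto (fun i => star (b i) * b i) l (𝓝 1) := by
    simpa only [hf.isEmbedding.tendsto_nhds_iff, Function.comp_def, map_mul, map_star, map_one]
      using tendsto_star_mul_self_of_tendsto_sub_unitary h
  have h_mul_star : Tendsto (fun i => b i * star (b i)) l (𝓝 1) := by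
    simpa only [hf.isEmbedding.tendsto_nhds_iff, Function.comp_def, map_mul, map_star, map_one,
      star_star] using tendsto_star_mul_self_of_tendsto_sub_unitary h_star
  obtain ⟨v, hv⟩ := exists_unitary_tendsto_sub h_star_mul h_mul_star
  have h_map : Tendsto (fun i => f (b i - v i)) l (𝓝 0) :=
    map_zero f ▸ (hf.continuous.tendsto 0).comp hv
  refine ⟨v, ?_⟩
  simpa only [map_sub, sub_sub_sub_cancel_left, sub_zero] using h.sub h_map

end AsymptoticallyUnitary

/-! ### Pointwise limits of automorphisms -/

section PointwiseLimit

variable {ι A B : Type*} [CStarAlgebra A] [CStarAlgebra B] {l : Filter ι}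

/-- The subalgebra on which a family of ⋆-homomorphisms converges pointwise to a given one. -/
def tendstoStarSubalgebra (φ : ι → A →⋆ₐ[ℂ] B) (ψ : A →⋆ₐ[ℂ] B) (l : Filter ι) :
    StarSubalgebra ℂ A where
  carrier := {a | Tendsto (φ · a) l (𝓝 (ψ a))}
  mul_mem' {a b} ha hb := by simpa only [Set.mem_ofPred_eq, map_mul] using ha.mul hb
  add_mem' {a b} ha hb := by simpa only [Set.mem_ofPred_eq, map_add] using ha.add hb
  star_mem' {a} ha := by simpa only [Set.mem_ofPred_eq, map_star] using ha.star
  algebraMap_mem' z := by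
    simpa only [Set.mem_ofPred_eq, AlgHomClass.commutes] using tendsto_const_nhds

theorem isClosed_tendstoStarSubalgebra (φ : ι → A →⋆ₐ[ℂ] B) (ψ : A →⋆ₐ[ℂ] B) :
    IsClosed (tendstoStarSubalgebra φ ψ l : Set A) := by
  have h_lipschitz : ∀ χ : A →⋆ₐ[ℂ] B, LipschitzWith 1 χ := fun χ =>
    AddMonoidHomClass.lipschitz_of_bound_nnnorm χ 1 fun a => by
      simpa using NonUnitalStarAlgHom.nnnorm_apply_le χ a
  exact (LipschitzWith.uniformEquicontinuous _ 1 fun i => h_lipschitz (φ i)).equicontinuous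
    |>.isClosed_setOfPred_tendsto (h_lipschitz ψ).continuous

theorem norm_conjStarAlgAut_sub_self (w : unitary A) (a : A) :
    ‖Unitary.conjStarAlgAut ℂ A w a - a‖ = ‖w * a - a * w‖ := by
  rw [← CStarRing.norm_mul_coe_unitary _ w, sub_mul, Unitary.conjStarAlgAut_apply, mul_assoc,
    Unitary.coe_star_mul_self, mul_one]

theorem tendsto_conjStarAlgAut_of_tendsto_sub {w w' : ι → unitary A} {a : A}
    (h_sub : Tendsto (fun i => (w' i - w i : A)) l (𝓝 0))
    (hw : Tendsto (fun i => Unitary.conjStarAlgAut ℂ A (w i) a) l (𝓝 a)) :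
    Tendsto (fun i => Unitary.conjStarAlgAut ℂ A (w' i) a) l (𝓝 a) := by
  rw [tendsto_iff_norm_sub_tendsto_zero] at hw ⊢
  simp only [norm_conjStarAlgAut_sub_self] at hw ⊢
  rw [← tendsto_zero_iff_norm_tendsto_zero] at hw ⊢
  have h := ((h_sub.mul_const a).sub (h_sub.const_mul a)).add hw
  rw [zero_mul, mul_zero, sub_zero, zero_add] at h
  exact h.congr fun i => by noncomm_ring

end PointwiseLimit

/-! ### Unitaries of the sequence algebra -/

namespace SeqAlgebra

variable {A : Type*} [CStarAlgebra A] [Nontrivial A]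

theorem mk_eq_mk_iff {a b : BoundedSeq A} :
    SeqAlgebra.mk A a = SeqAlgebra.mk A b ↔ Tendsto (fun n => a n - b n) atTop (𝓝 0) := by
  rw [Ideal.Quotient.eq, mem_nullSeqIdeal]
  exact tendsto_zero_iff_norm_tendsto_zero.symm

theorem star_mk (a : BoundedSeq A) : star (SeqAlgebra.mk A a) = SeqAlgebra.mk A (star a) := rfl

/-- A sequence of unitaries, as a bounded sequence. -/
def unitarySeq (v : ℕ → unitary A) : BoundedSeq A :=
  ⟨fun n => v n, memℓp_infty ⟨1, by rintro _ ⟨n, rfl⟩; exact (CStarRing.norm_coe_unitary (v n)).le⟩⟩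

theorem unitarySeq_mem_unitary (v : ℕ → unitary A) : unitarySeq v ∈ unitary (BoundedSeq A) := by
  refine Unitary.mem_iff.mpr ⟨lp.ext (funext fun n => ?_), lp.ext (funext fun n => ?_)⟩
  · exact Unitary.coe_star_mul_self (v n)
  · exact Unitary.coe_mul_star_self (v n)

theorem mk_mem_unitary {a : BoundedSeq A} (ha : a ∈ unitary (BoundedSeq A)) :
    SeqAlgebra.mk A a ∈ unitary (SeqAlgebra A) := by
  rw [Unitary.mem_iff] at ha ⊢
  rw [star_mk, ← map_mul, ← map_mul, ha.1, ha.2, map_one]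
  exact ⟨rfl, rfl⟩

theorem mem_unitary_iff_exists_mk_unitarySeq {x : SeqAlgebra A} :
    x ∈ unitary (SeqAlgebra A) ↔ ∃ v, SeqAlgebra.mk A (unitarySeq v) = x := by
  refine ⟨fun hx => ?_, ?_⟩
  · obtain ⟨a, rfl⟩ := Ideal.Quotient.mk_surjective x
    rw [Unitary.mem_iff, star_mk, ← map_mul, ← map_mul, ← map_one (SeqAlgebra.mk A),
      mk_eq_mk_iff, mk_eq_mk_iff] at hx
    obtain ⟨v, hv⟩ := exists_unitary_tendsto_sub (a := a)
      (tendsto_sub_nhds_zero_iff.mp hx.1) (tendsto_sub_nhds_zero_iff.mp hx.2)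
    exact ⟨v, (mk_eq_mk_iff.mpr hv).symm⟩
  · rintro ⟨v, rfl⟩
    exact mk_mem_unitary (unitarySeq_mem_unitary v)

theorem map_mk_unitarySeq_eq_iff {φ : A ≃⋆ₐ[ℂ] A} {v : ℕ → unitary A} :
    map φ (SeqAlgebra.mk A (unitarySeq v)) = SeqAlgebra.mk A (unitarySeq v) ↔
      Tendsto (fun n => φ (v n) - v n) atTop (𝓝 0) :=
  mk_eq_mk_iff (a := mapSeq φ (unitarySeq v))

theorem const_eq_mk_unitarySeq_conj_iff {v : ℕ → unitary A} {a b : A} :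
    const A a = SeqAlgebra.mk A (unitarySeq v) * const A b * star (SeqAlgebra.mk A (unitarySeq v)) ↔
      Tendsto (fun n => Unitary.conjStarAlgAut ℂ A (v n) b) atTop (𝓝 a) := by
  rw [eq_comm, star_mk, const, const, ← map_mul, ← map_mul, mk_eq_mk_iff]
  exact tendsto_sub_nhds_zero_iff (u := fun n => Unitary.conjStarAlgAut ℂ A (v n) b)

end SeqAlgebra

theorem isApproxRepresentable_iff_exists_seq {A : Type*} [CStarAlgebra A] [Nontrivial A]
    {φ : A ≃⋆ₐ[ℂ] A} :
    IsApproxRepresentable φ ↔ ∃ v : ℕ → unitary A,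
      Tendsto (fun n => (φ (v n) - v n : A)) atTop (𝓝 0) ∧
        ∀ a, Tendsto (fun n => Unitary.conjStarAlgAut ℂ A (v n) a) atTop (𝓝 (φ a)) := by
  simp only [IsApproxRepresentable, SeqAlgebra.mem_unitary_iff_exists_mk_unitarySeq,
    exists_exists_eq_and, SeqAlgebra.map_mk_unitarySeq_eq_iff,
    SeqAlgebra.const_eq_mk_unitarySeq_conj_iff]

/-! ### The Rokhlin property along sequences of unitaries -/

namespace CircleAction

open TopologicalSpace

variable {A : Type*} [CStarAlgebra A] (α : CircleAction A)

variable {α} in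
theorem HasRokhlinProperty.exists_seq [SeparableSpace A] (h : α.HasRokhlinProperty) :
    ∃ w : ℕ → unitary A,
      TendstoUniformly (fun n ζ => α.toHom ζ (w n) - (ζ : ℂ) • (w n : A)) 0 atTop ∧
        ∀ a, Tendsto (fun n => Unitary.conjStarAlgAut ℂ A (w n) a) atTop (𝓝 a) := by
  classical
  choose w hw h_eigen h_comm using fun n : ℕ =>
    h (1 / (n + 1)) Nat.one_div_pos_of_nat ((Finset.range (n + 1)).image (denseSeq A))
  refine ⟨fun n => ⟨w n, hw n⟩, Metric.tendstoUniformly_iff.mpr fun ε hε => ?_, fun a => ?_⟩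
  · filter_upwards [tendsto_one_div_add_atTop_nhds_zero_nat.eventually_lt_const hε] with n hn ζ
    simpa only [Pi.zero_apply, dist_zero_left] using (h_eigen n ζ).trans hn
  · let S := tendstoStarSubalgebra
      (fun n => (Unitary.conjStarAlgAut ℂ A ⟨w n, hw n⟩ : A →⋆ₐ[ℂ] A)) (.id ℂ A) atTop
    have h_denseSeq : Set.range (denseSeq A) ⊆ S := by
      rintro _ ⟨k, rfl⟩
      refine tendsto_iff_norm_sub_tendsto_zero.mpr (squeeze_zero' (.of_forall fun n =>
        norm_nonneg _) ?_ tendsto_one_div_add_atTop_nhds_zero_nat)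
      filter_upwards [eventually_ge_atTop k] with n hn
      exact (norm_conjStarAlgAut_sub_self _ _).trans_le
        (h_comm n _ (Finset.mem_image_of_mem _ (Finset.mem_range_succ_iff.mpr hn))).le
    exact (isClosed_tendstoStarSubalgebra _ _).closure_subset_iff.mpr h_denseSeq
      (denseRange_denseSeq A a)

theorem hasRokhlinProperty_of_tendsto {ι : Type*} {l : Filter ι} [l.NeBot] {w : ι → unitary A}
    (h_eigen : TendstoUniformly (fun i ζ => α.toHom ζ (w i) - (ζ : ℂ) • (w i : A)) 0 l)
    (h_conj : ∀ a, Tendsto (fun i => Unitary.conjStarAlgAut ℂ A (w i) a) l (𝓝 a)) :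
    α.HasRokhlinProperty := by
  intro ε hε F
  have h_comm : ∀ᶠ i in l, ∀ a ∈ F, ‖(w i * a - a * w i : A)‖ < ε := by
    refine (Filter.eventually_all_finset F).mpr fun a _ => ?_
    filter_upwards [(tendsto_iff_norm_sub_tendsto_zero.mp (h_conj a)).eventually_lt_const hε]
      with i hi
    rwa [norm_conjStarAlgAut_sub_self] at hi
  obtain ⟨i, hi_eigen, hi_comm⟩ :=
    ((Metric.tendstoUniformly_iff.mp h_eigen ε hε).and h_comm).exists
  refine ⟨w i, (w i).2, fun ζ => ?_, hi_comm⟩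
  simpa only [Pi.zero_apply, dist_zero_left] using hi_eigen ζ

end CircleAction

namespace CircleAction

open AddCircle MeasureTheory

variable {A : Type*} [CStarAlgebra A] (α : CircleAction A)

theorem norm_toHom_apply (ζ : Circle) (a : A) : ‖α.toHom ζ a‖ = ‖a‖ :=
  NonUnitalStarAlgHom.norm_map (α.toHom ζ : A →⋆ₐ[ℂ] A) (α.toHom ζ).injective a

theorem integrable_toHom_apply (a : A) :
    Integrable (fun t : UnitAddCircle => α.toHom t.toCircle a) haarAddCircle :=
  ((α.continuous_apply a).comp continuous_toCircle).integrable_of_hasCompactSupport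
    (.of_compactSpace _)

/-- The conditional expectation onto the fixed points of a circle action, which averages over the
orbits. The circle is parametrised by `ℝ / ℤ`, on which Mathlib has the normalised Haar measure. -/
def expectation : A →L[ℂ] A :=
  LinearMap.mkContinuous
    { toFun a := ∫ t : UnitAddCircle, α.toHom t.toCircle a ∂haarAddCircle
      map_add' a b := by
        simp only [map_add]
        exact integral_add (α.integrable_toHom_apply a) (α.integrable_toHom_apply b)
      map_smul' z a := by
        simp only [map_smul]
        exact integral_smul z _ } 1 fun a => by
    simpa [one_mul] using norm_integral_le_of_norm_le_const (μ := haarAddCircle)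
      (.of_forall fun t : UnitAddCircle => (α.norm_toHom_apply t.toCircle a).le)

theorem expectation_apply (a : A) :
    α.expectation a = ∫ t : UnitAddCircle, α.toHom t.toCircle a ∂haarAddCircle := rfl

variable {α}

theorem norm_expectation_sub_le {a : A} {ε : ℝ} (h : ∀ ζ, ‖α.toHom ζ a - a‖ ≤ ε) :
    ‖α.expectation a - a‖ ≤ ε := by
  have h_sub : α.expectation a - a =
      ∫ t : UnitAddCircle, (α.toHom t.toCircle a - a) ∂haarAddCircle := by
    rw [integral_sub (α.integrable_toHom_apply a) (integrable_const a), integral_const,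
      probReal_univ, one_smul, expectation_apply]
  rw [h_sub]
  simpa using norm_integral_le_of_norm_le_const (μ := haarAddCircle)
    (.of_forall fun t : UnitAddCircle => h t.toCircle)

theorem tendsto_expectation_sub {ι : Type*} {l : Filter ι} {a : ι → A}
    (h : TendstoUniformly (fun i ζ => α.toHom ζ (a i) - a i) 0 l) :
    Tendsto (fun i => α.expectation (a i) - a i) l (𝓝 0) := by
  refine Metric.nhds_basis_closedBall.tendsto_right_iff.mpr fun ε hε => ?_
  filter_upwards [Metric.tendstoUniformly_iff.mp h ε hε] with i hi
  rw [mem_closedBall_zero_iff]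
  exact norm_expectation_sub_le fun ζ => by simpa [dist_eq_norm'] using (hi ζ).le

theorem expectation_of_fixed {a : A} (h : ∀ ζ, α.toHom ζ a = a) : α.expectation a = a :=
  sub_eq_zero.mp (norm_le_zero_iff.mp (norm_expectation_sub_le fun ζ => by simp [h ζ]))

theorem expectation_of_eigenvector {a : A} {n : ℤ} (hn : n ≠ 0)
    (h : ∀ ζ, α.toHom ζ a = ((ζ ^ n : Circle) : ℂ) • a) : α.expectation a = 0 := by
  refine integral_eq_zero_of_add_right_eq_neg (g := ((1 / 2 / n : ℝ) : UnitAddCircle)) fun t => ?_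
  have h_neg := fourier_add_half_inv_index hn one_pos t
  simp only [fourier_apply, toCircle_zsmul] at h_neg
  simp only [h]
  rw [h_neg, neg_smul]

end CircleAction

/-! ### Adjoint operators on Hilbert C⋆-modules -/

section Adjoint

variable {A E : Type*} [NonUnitalCStarAlgebra A] [PartialOrder A]
  [NormedAddCommGroup E] [NormedSpace ℂ E] [SMul A E] [CStarModule A E]

variable (A) in
/-- `S` is an adjoint of `T` with respect to the `A`-valued inner product of `E`. Unlike on a
Hilbert space, a bounded operator need not have one. -/
def IsModuleAdjoint (S T : E →L[ℂ] E) : Prop := ∀ x y, inner A (T x) y = inner A x (S y)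

namespace IsModuleAdjoint

variable {S T : E →L[ℂ] E}

theorem symm (h : IsModuleAdjoint A S T) : IsModuleAdjoint A T S := fun x y => by
  rw [← CStarModule.star_inner, ← h y x, CStarModule.star_inner]

variable [StarOrderedRing A]

theorem norm_mul_self_le_norm_comp (h : IsModuleAdjoint A S T) : ‖T‖ * ‖T‖ ≤ ‖S ∘L T‖ := by
  rw [← sq, ← Real.le_sqrt (norm_nonneg _) (norm_nonneg _)]
  refine T.opNorm_le_bound (Real.sqrt_nonneg _) fun x => ?_
  rw [← Real.sqrt_sq (norm_nonneg x), ← Real.sqrt_mul (norm_nonneg _)]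
  refine Real.le_sqrt_of_sq_le ?_
  calc ‖T x‖ ^ 2 = ‖inner A x ((S ∘L T) x)‖ := by
        rw [CStarModule.norm_sq_eq A, h]; rfl
    _ ≤ ‖x‖ * ‖(S ∘L T) x‖ := CStarModule.norm_inner_le E
    _ ≤ ‖x‖ * (‖S ∘L T‖ * ‖x‖) := by gcongr; exact (S ∘L T).le_opNorm x
    _ = ‖S ∘L T‖ * ‖x‖ ^ 2 := by ring

theorem norm_le (h : IsModuleAdjoint A S T) : ‖T‖ ≤ ‖S‖ := by
  have h_mul := h.norm_mul_self_le_norm_comp.trans (S.opNorm_comp_le T)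
  by_contra! h_lt
  exact absurd h_mul (not_le.mpr (mul_lt_mul_of_pos_right h_lt ((norm_nonneg S).trans_lt h_lt)))

theorem norm_eq (h : IsModuleAdjoint A S T) : ‖S‖ = ‖T‖ := le_antisymm h.symm.norm_le h.norm_le

theorem norm_comp_self (h : IsModuleAdjoint A S T) : ‖S ∘L T‖ = ‖T‖ * ‖T‖ :=
  le_antisymm ((S.opNorm_comp_le T).trans_eq (by rw [h.norm_eq])) h.norm_mul_self_le_norm_comp

end IsModuleAdjoint

end Adjoint

/-! ### The regular representation -/

namespace ConvAlg

variable {B : Type*} [CStarAlgebra B] {β : B ≃⋆ₐ[ℂ] B}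

/-- The coefficient `bₙ` of `∑ bₙ uⁿ`. -/
def coeff (n : ZAct β) : ConvAlg β →ₗ[ℂ] B where
  toFun f := SkewMonoidAlgebra.coeff f n
  map_add' f g := DFunLike.congr_fun (SkewMonoidAlgebra.coeff_add f g) n
  map_smul' _ _ := rfl

theorem coeff_mono_same (n : ZAct β) (b : B) : coeff n (mono β n b) = b := by
  classical
  exact (SkewMonoidAlgebra.coeff_single_apply).trans (if_pos rfl)

theorem coeff_mono_of_ne {m n : ZAct β} (h : m ≠ n) (b : B) : coeff n (mono β m b) = 0 := by
  classical
  exact (SkewMonoidAlgebra.coeff_single_apply).trans (if_neg h)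

theorem coeff_mul_mono (m n : ZAct β) (f : ConvAlg β) (b : B) :
    coeff n (f * mono β m b) = coeff (n * m⁻¹) f * (n * m⁻¹) • b :=
  SkewMonoidAlgebra.coeff_mul_single f b m n

theorem coeff_mono_one_mul (n : ZAct β) (f : ConvAlg β) (b : B) :
    coeff n (mono β 1 b * f) = b * coeff n f :=
  SkewMonoidAlgebra.coeff_single_one_mul f b n

theorem coeff_one_star (f : ConvAlg β) : coeff 1 (star f) = star (coeff 1 f) := by
  induction f using induct with
  | zero => simp only [star_zero, map_zero]
  | mono n b =>
    rw [star_mono]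
    rcases eq_or_ne n 1 with rfl | hn
    · rw [inv_one, one_smul, coeff_mono_same, coeff_mono_same]
    · rw [coeff_mono_of_ne hn, coeff_mono_of_ne (inv_ne_one.mpr hn), star_zero]
  | add f g hf hg => rw [star_add, map_add, hf, hg, map_add, star_add]

theorem coeff_one_mul_star (f g : ConvAlg β) : coeff 1 (f * star g) =
    SkewMonoidAlgebra.sum g fun n b => coeff n f * star b := by
  induction g using induct with
  | zero =>
    rw [star_zero, mul_zero, map_zero]
    exact SkewMonoidAlgebra.sum_zero_index.symm
  | mono n b =>
    rw [star_mono, coeff_mul_mono, inv_inv, one_mul, smul_inv_smul]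
    exact (SkewMonoidAlgebra.sum_single_index
      (h := fun n b => coeff n f * star b) (by rw [star_zero, mul_zero])).symm
  | add g₁ g₂ h₁ h₂ =>
    rw [star_add, mul_add, map_add, h₁, h₂]
    exact (SkewMonoidAlgebra.sum_add_index'
      (h := fun n b => coeff n f * star b) (fun n => by rw [star_zero, mul_zero])
      fun n a b => by rw [star_add, mul_add]).symm

theorem mono_mul_star_self (n : ZAct β) (b : B) :
    mono β n b * star (mono β n b) = mono β 1 (b * star b) := by
  rw [star_mono, mono_mul, mul_inv_cancel, smul_inv_smul]

section Order

variable [PartialOrder B] [StarOrderedRing B]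

theorem coeff_one_mul_star_self_nonneg (f : ConvAlg β) : 0 ≤ coeff 1 (f * star f) := by
  rw [coeff_one_mul_star]
  exact Finset.sum_nonneg fun n _ => mul_star_self_nonneg (coeff n f)

theorem coeff_one_mul_star_self_eq_zero {f : ConvAlg β} : coeff 1 (f * star f) = 0 ↔ f = 0 := by
  refine ⟨fun h => ?_, fun h => by rw [h, zero_mul, map_zero]⟩
  rw [coeff_one_mul_star] at h
  have h_coeff := (Finset.sum_eq_zero_iff_of_nonneg
    fun n _ => mul_star_self_nonneg (coeff n f)).mp h
  refine SkewMonoidAlgebra.coeff_injective (Finsupp.ext fun n => ?_)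
  by_contra hn
  exact hn ((CStarRing.mul_star_self_eq_zero_iff _).mp (h_coeff n (Finsupp.mem_support_iff.mpr hn)))

theorem coeff_one_conj_mono_one_le (f : ConvAlg β) {a b : B} (h : a ≤ b) :
    coeff 1 (f * mono β 1 a * star f) ≤ coeff 1 (f * mono β 1 b * star f) := by
  obtain ⟨c, hc⟩ := CStarAlgebra.nonneg_iff_eq_mul_star_self.mp (sub_nonneg.mpr h)
  have h_conj : f * mono β 1 b * star f =
      f * mono β 1 a * star f + f * mono β 1 c * star (f * mono β 1 c) := by
    rw [sub_eq_iff_eq_add'.mp hc, mono_add, mul_add, add_mul, star_mul, ← mul_assoc,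
      mul_assoc f (mono β 1 c), mono_mul_star_self]
  rw [h_conj, map_add]
  exact le_add_of_nonneg_right (coeff_one_mul_star_self_nonneg _)

theorem coeff_one_mul_mono_mul_star_le (f : ConvAlg β) (n : ZAct β) (b : B) :
    coeff 1 (f * mono β n b * star (f * mono β n b)) ≤ ‖b‖ ^ 2 • coeff 1 (f * star f) := by
  have h_le : b * star b ≤ algebraMap ℝ B (‖b‖ ^ 2) := by
    rw [sq, ← CStarRing.norm_self_mul_star]
    exact (IsSelfAdjoint.mul_star_self b).le_algebraMap_norm_self
  have h_algebraMap : mono β 1 (algebraMap ℝ B (‖b‖ ^ 2)) = ((‖b‖ ^ 2 : ℝ) : ℂ) • 1 := by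
    rw [one_def, smul_mono, Algebra.algebraMap_eq_smul_one]
    rfl
  calc coeff 1 (f * mono β n b * star (f * mono β n b))
      = coeff 1 (f * mono β 1 (b * star b) * star f) := by
        rw [star_mul, ← mul_assoc, mul_assoc f, mono_mul_star_self]
    _ ≤ coeff 1 (f * mono β 1 (algebraMap ℝ B (‖b‖ ^ 2)) * star f) :=
        coeff_one_conj_mono_one_le f h_le
    _ = ‖b‖ ^ 2 • coeff 1 (f * star f) := by
        rw [h_algebraMap, mul_smul_comm, mul_one, smul_mul_assoc, map_smul, Complex.coe_smul]

end Order

end ConvAlg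

/-- `C_c(ℤ, B, β)` as a pre-Hilbert `B`-module, with the inner product `⟪x, y⟫ = ∑ yₙ xₙ*`, which
is the coefficient of `u⁰` in `y x*`. It is the module of the right regular representation. The
type synonym keeps its norm apart from the universal norm of the algebra. -/
def RegularModule {B : Type*} [CStarAlgebra B] (β : B ≃⋆ₐ[ℂ] B) : Type _ := ConvAlg β

namespace RegularModule

open ConvAlg

variable {B : Type*} [CStarAlgebra B] (β : B ≃⋆ₐ[ℂ] B)

attribute [local instance] CStarAlgebra.spectralOrder CStarAlgebra.spectralOrderedRing

instance instAddCommGroup : AddCommGroup (RegularModule β) :=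
  inferInstanceAs (AddCommGroup (ConvAlg β))

instance instModule : Module ℂ (RegularModule β) := inferInstanceAs (Module ℂ (ConvAlg β))

/-- The identification of `C_c(ℤ, B, β)` with the module of its regular representation. -/
def ofConvAlg : ConvAlg β ≃ₗ[ℂ] RegularModule β := LinearEquiv.refl ℂ (ConvAlg β)

instance instSMul : SMul B (RegularModule β) where
  smul b x := ofConvAlg β (mono β 1 b * (ofConvAlg β).symm x)

theorem smul_ofConvAlg (b : B) (f : ConvAlg β) :
    b • ofConvAlg β f = ofConvAlg β (mono β 1 b * f) := rfl

instance instInner : Inner B (RegularModule β) where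
  inner x y := coeff 1 ((ofConvAlg β).symm y * star ((ofConvAlg β).symm x))

theorem inner_ofConvAlg (f g : ConvAlg β) :
    inner B (ofConvAlg β f) (ofConvAlg β g) = coeff 1 (g * star f) := rfl

instance instNorm : Norm (RegularModule β) := CStarModule.norm B

instance instCStarModule : CStarModule B (RegularModule β) where
  inner_add_right {x y z} := by
    simp only [inner, map_add, add_mul]
  inner_self_nonneg {x} := coeff_one_mul_star_self_nonneg _
  inner_self {x} := coeff_one_mul_star_self_eq_zero
  inner_op_smul_right {b x y} := by
    obtain ⟨f, rfl⟩ := (ofConvAlg β).surjective x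
    obtain ⟨g, rfl⟩ := (ofConvAlg β).surjective y
    rw [smul_ofConvAlg, inner_ofConvAlg, inner_ofConvAlg, mul_assoc, coeff_mono_one_mul]
  inner_smul_right_complex {z x y} := by simp only [inner, map_smul, smul_mul_assoc]
  star_inner x y := by
    obtain ⟨f, rfl⟩ := (ofConvAlg β).surjective x
    obtain ⟨g, rfl⟩ := (ofConvAlg β).surjective y
    rw [inner_ofConvAlg, inner_ofConvAlg, ← coeff_one_star, star_mul, star_star]
  norm_eq_sqrt_norm_inner_self _ := rfl

instance instNormedAddCommGroup : NormedAddCommGroup (RegularModule β) :=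
  CStarModule.normedAddCommGroup B

instance instNormedSpace : NormedSpace ℂ (RegularModule β) :=
  .ofCore (CStarModule.normedSpaceCore B)

theorem norm_sq_ofConvAlg (f : ConvAlg β) : ‖ofConvAlg β f‖ ^ 2 = ‖coeff 1 (f * star f)‖ :=
  CStarModule.norm_sq_eq B

theorem norm_ofConvAlg_mul_mono_le (f : ConvAlg β) (n : ZAct β) (b : B) :
    ‖ofConvAlg β (f * mono β n b)‖ ≤ ‖b‖ * ‖ofConvAlg β f‖ := by
  refine le_of_sq_le_sq ?_ (by positivity)
  calc ‖ofConvAlg β (f * mono β n b)‖ ^ 2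
      ≤ ‖‖b‖ ^ 2 • coeff 1 (f * star f)‖ := by
        rw [norm_sq_ofConvAlg]
        exact CStarAlgebra.norm_le_norm_of_nonneg_of_le (coeff_one_mul_star_self_nonneg _)
          (coeff_one_mul_mono_mul_star_le f n b)
    _ = (‖b‖ * ‖ofConvAlg β f‖) ^ 2 := by
        rw [norm_smul, norm_pow, norm_norm, mul_pow, norm_sq_ofConvAlg]

theorem norm_ofConvAlg_mul_le (f g : ConvAlg β) :
    ‖ofConvAlg β (f * g)‖ ≤ l1Norm g * ‖ofConvAlg β f‖ := by
  have h_sum : g = ∑ n ∈ (SkewMonoidAlgebra.coeff g).support, mono β n (coeff n g) :=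
    (SkewMonoidAlgebra.sum_single g).symm
  calc ‖ofConvAlg β (f * g)‖
      = ‖∑ n ∈ (SkewMonoidAlgebra.coeff g).support, ofConvAlg β (f * mono β n (coeff n g))‖ := by
        conv_lhs => rw [h_sum, Finset.mul_sum, map_sum]
    _ ≤ ∑ n ∈ (SkewMonoidAlgebra.coeff g).support, ‖coeff n g‖ * ‖ofConvAlg β f‖ :=
        norm_sum_le_of_le _ fun n _ => norm_ofConvAlg_mul_mono_le β f n _
    _ = l1Norm g * ‖ofConvAlg β f‖ := (Finset.sum_mul _ _ _).symm

/-- The right regular representation of `C_c(ℤ, B, β)`, by bounded operators. -/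
def rightRegular : ConvAlg β →ₗ[ℂ] RegularModule β →L[ℂ] RegularModule β where
  toFun f := LinearMap.mkContinuous
    (ofConvAlg β ∘ₗ LinearMap.mulRight ℂ f ∘ₗ (ofConvAlg β).symm) (l1Norm f)
    fun x => norm_ofConvAlg_mul_le β ((ofConvAlg β).symm x) f
  map_add' f g := ContinuousLinearMap.ext fun _ => congrArg (ofConvAlg β) (mul_add _ f g)
  map_smul' z f := ContinuousLinearMap.ext fun _ => congrArg (ofConvAlg β) (mul_smul_comm z _ f)

theorem rightRegular_ofConvAlg (f g : ConvAlg β) :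
    rightRegular β f (ofConvAlg β g) = ofConvAlg β (g * f) := rfl

theorem rightRegular_mul (f g : ConvAlg β) :
    rightRegular β (f * g) = rightRegular β g ∘L rightRegular β f :=
  ContinuousLinearMap.ext fun _ => congrArg (ofConvAlg β) (mul_assoc _ f g).symm

theorem isModuleAdjoint_rightRegular_star (f : ConvAlg β) :
    IsModuleAdjoint B (rightRegular β (star f)) (rightRegular β f) := fun x y => by
  obtain ⟨g, rfl⟩ := (ofConvAlg β).surjective x
  obtain ⟨h, rfl⟩ := (ofConvAlg β).surjective y
  rw [rightRegular_ofConvAlg, rightRegular_ofConvAlg, inner_ofConvAlg, inner_ofConvAlg, star_mul,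
    mul_assoc]

theorem rightRegular_injective : Function.Injective (rightRegular β) := fun f g h => by
  have h_one := DFunLike.congr_fun h (ofConvAlg β 1)
  rwa [rightRegular_ofConvAlg, rightRegular_ofConvAlg, one_mul, one_mul,
    EmbeddingLike.apply_eq_iff_eq] at h_one

theorem isCStarSeminorm_norm_rightRegular :
    IsCStarSeminorm ((normSeminorm ℂ (RegularModule β →L[ℂ] RegularModule β)).comp
      (rightRegular β)) where
  mul_le f g := by
    rw [Seminorm.comp_apply, rightRegular_mul, mul_comm]
    exact ContinuousLinearMap.opNorm_comp_le _ _
  star_mul_self f := by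
    have h := isModuleAdjoint_rightRegular_star β f
    rw [Seminorm.comp_apply, Seminorm.comp_apply, rightRegular_mul, coe_normSeminorm,
      h.symm.norm_comp_self, h.norm_eq]
  le_l1Norm f := ContinuousLinearMap.opNorm_le_bound _ (l1Norm_nonneg f) fun x =>
    norm_ofConvAlg_mul_le β ((ofConvAlg β).symm x) f

end RegularModule

namespace CrossedProduct

variable {B : Type*} [CStarAlgebra B] (β : B ≃⋆ₐ[ℂ] B)

theorem of_injective : Function.Injective (of : ConvAlg β → CrossedProduct β) := fun f g h => by
  have h_norm : ‖RegularModule.rightRegular β (f - g)‖ ≤ ‖f - g‖ :=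
    ConvAlg.le_maxNorm ⟨_, RegularModule.isCStarSeminorm_norm_rightRegular β⟩ (f - g)
  have h_zero : ‖f - g‖ = 0 := by
    rw [← norm_of, sub_eq_add_neg, of_add, h, ← of_add, add_neg_cancel, norm_of, norm_zero]
  refine RegularModule.rightRegular_injective β (sub_eq_zero.mp ?_)
  rw [← map_sub]
  exact norm_le_zero_iff.mp (h_norm.trans_eq h_zero)

end CrossedProduct

/-! ### The structure of the crossed product -/

/-- The generator `1` of `ℤ`, written multiplicatively. -/
def ZAct.generator {B : Type*} [CStarAlgebra B] (β : B ≃⋆ₐ[ℂ] B) : ZAct β :=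
  Multiplicative.ofAdd (1 : ℤ)

namespace ZAct

variable {B : Type*} [CStarAlgebra B] {β : B ≃⋆ₐ[ℂ] B}

theorem toInt_generator : (generator β).toInt = 1 := rfl

theorem generator_zpow_toInt (n : ZAct β) : generator β ^ n.toInt = n :=
  (ofAdd_zsmul n.toInt (1 : ℤ)).symm.trans (congrArg Multiplicative.ofAdd (mul_one n.toInt))

theorem generator_smul (b : B) : generator β • b = β b := rfl

end ZAct

namespace CrossedProduct

open ConvAlg

variable {B : Type*} [CStarAlgebra B] (β : B ≃⋆ₐ[ℂ] B)

/-- The canonical embedding of `B` into `B ⋊_β ℤ`. -/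
def inclusion : B →⋆ₐ[ℂ] CrossedProduct β where
  toFun b := of (mono β 1 b)
  map_one' := rfl
  map_mul' a b := by rw [← of_mul, mono_mul, mul_one, one_smul]
  map_zero' := by rw [mono_zero]; rfl
  map_add' a b := by rw [mono_add, of_add]
  commutes' z := by
    rw [Algebra.algebraMap_eq_smul_one, Algebra.algebraMap_eq_smul_one, ← smul_mono, of_smul]
    rfl
  map_star' b := by rw [star_of, star_mono, inv_one, one_smul]

theorem inclusion_apply (b : B) : inclusion β b = of (mono β 1 b) := rfl

theorem isometry_inclusion : Isometry (inclusion β) :=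
  NonUnitalStarAlgHom.isometry (inclusion β) fun a b h => by
    rw [← coeff_mono_same (β := β) 1 a, of_injective β h, coeff_mono_same]

variable {β} in
theorem mono_one_mem_unitary (n : ZAct β) : of (mono β n 1) ∈ unitary (CrossedProduct β) := by
  have h_one : (1 : CrossedProduct β) = of (mono β 1 1) := rfl
  simp only [Unitary.mem_iff, star_of, star_mono, star_one, smul_one, ← of_mul, mono_mul,
    mul_one, inv_mul_cancel, mul_inv_cancel, h_one, and_self]

/-- The homomorphism `n ↦ uⁿ` from `ℤ` to the unitaries of `B ⋊_β ℤ`. -/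
def zpowUnitary : ZAct β →* unitary (CrossedProduct β) where
  toFun n := ⟨of (mono β n 1), mono_one_mem_unitary n⟩
  map_one' := rfl
  map_mul' m n := Subtype.ext <| by
    simp only [Submonoid.coe_mul, ← of_mul, mono_mul, smul_one, mul_one]

variable {β} in
theorem coe_zpowUnitary (n : ZAct β) : (zpowUnitary β n : CrossedProduct β) = of (mono β n 1) := rfl

/-- The canonical unitary `u` of `B ⋊_β ℤ`, which implements `β`. -/
def canonicalUnitary : unitary (CrossedProduct β) := zpowUnitary β (ZAct.generator β)

variable {β} in
theorem of_mono (n : ZAct β) (b : B) :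
    of (mono β n b) = inclusion β b * (canonicalUnitary β ^ n.toInt : unitary _) := by
  rw [canonicalUnitary, ← map_zpow, ZAct.generator_zpow_toInt, inclusion_apply, coe_zpowUnitary,
    ← of_mul, mono_mul, one_mul, one_smul, mul_one]

theorem conjStarAlgAut_canonicalUnitary (b : B) :
    Unitary.conjStarAlgAut ℂ _ (canonicalUnitary β) (inclusion β b) = inclusion β (β b) := by
  rw [Unitary.conjStarAlgAut_apply, canonicalUnitary, coe_zpowUnitary, inclusion_apply,
    inclusion_apply, star_of, star_mono, ← of_mul, ← of_mul, mono_mul, mono_mul, mul_one,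
    mul_inv_cancel, one_mul, star_one, smul_one, smul_one, mul_one, ZAct.generator_smul]

theorem dualAction_of_mono (ζ : Circle) (n : ZAct β) (b : B) :
    (dualAction β).toHom ζ (of (mono β n b)) =
      ((ζ ^ n.toInt : Circle) : ℂ) • of (mono β n b) := by
  rw [← of_smul, smul_mono, ← gaugeHom_mono]
  exact gauge_of β ζ _

theorem dualAction_inclusion (ζ : Circle) (b : B) :
    (dualAction β).toHom ζ (inclusion β b) = inclusion β b := by
  rw [inclusion_apply, dualAction_of_mono, ZAct.toInt_one, zpow_zero, Circle.coe_one, one_smul]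

theorem dualAction_canonicalUnitary (ζ : Circle) :
    (dualAction β).toHom ζ (canonicalUnitary β) =
      (ζ : ℂ) • (canonicalUnitary β : CrossedProduct β) := by
  rw [canonicalUnitary, coe_zpowUnitary, dualAction_of_mono, ZAct.toInt_generator, zpow_one]

variable {β}

theorem induction_mono {p : CrossedProduct β → Prop} (x : CrossedProduct β)
    (closed : IsClosed {x | p x}) (mono : ∀ n b, p (of (mono β n b)))
    (add : ∀ x y, p x → p y → p (x + y)) : p x := by
  induction x using induct with
  | closed => exact closed
  | of f =>
    induction f using ConvAlg.induct with
    | zero => simpa only [mono_zero] using mono 1 0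
    | mono n b => exact mono n b
    | add f g hf hg => rw [of_add]; exact add _ _ hf hg

theorem starSubalgebra_eq_top {S : StarSubalgebra ℂ (CrossedProduct β)}
    (hS : IsClosed (S : Set (CrossedProduct β))) (h_inclusion : ∀ b, inclusion β b ∈ S)
    (h_unitary : (canonicalUnitary β : CrossedProduct β) ∈ S) : S = ⊤ := by
  have h_zpow (n : ℤ) : ((canonicalUnitary β ^ n : unitary _) : CrossedProduct β) ∈ S := by
    refine zpow_induction_right (P := fun w : unitary (CrossedProduct β) =>
      (w : CrossedProduct β) ∈ S)
      (one_mem S) (fun w hw => mul_mem hw h_unitary)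
      (fun w hw => mul_mem hw (star_mem h_unitary)) n
  suffices ∀ x, x ∈ S from top_unique fun x _ => this x
  intro x
  induction x using induction_mono with
  | closed => exact hS
  | mono n b => rw [of_mono]; exact mul_mem (h_inclusion b) (h_zpow _)
  | add x y hx hy => exact add_mem hx hy

instance instSeparableSpace [TopologicalSpace.SeparableSpace B] :
    TopologicalSpace.SeparableSpace (CrossedProduct β) := by
  have : Countable (ZAct β) := inferInstanceAs (Countable (Multiplicative ℤ))
  have h_mono : TopologicalSpace.IsSeparable (⋃ n, Set.range fun b => of (mono β n b)) :=
    .iUnion fun n => TopologicalSpace.isSeparable_range <|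
      (UniformSpace.Completion.continuous_coe (ConvAlg β)).comp (continuous_mono β n)
  rw [← TopologicalSpace.isSeparable_univ_iff]
  suffices ∀ x, x ∈ (Submodule.span ℂ _).topologicalClosure from
    (h_mono.span (R := ℂ)).closure.mono fun x _ => this x
  intro x
  induction x using induction_mono with
  | closed => exact isClosed_closure
  | mono n b => exact subset_closure (Submodule.subset_span (Set.mem_iUnion.mpr ⟨n, b, rfl⟩))
  | add x y hx hy => exact (Submodule.topologicalClosure _).add_mem hx hy

theorem expectation_mem_range_inclusion (x : CrossedProduct β) :
    (dualAction β).expectation x ∈ Set.range (inclusion β) := by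
  induction x using induction_mono with
  | closed =>
    exact (isometry_inclusion β).isClosedEmbedding.isClosed_range.preimage
      (dualAction β).expectation.continuous
  | mono n b =>
    rcases eq_or_ne n 1 with rfl | hn
    · exact ⟨b, (CircleAction.expectation_of_fixed (dualAction_inclusion β · b)).symm⟩
    · rw [CircleAction.expectation_of_eigenvector (n := n.toInt) hn (dualAction_of_mono β · n b)]
      exact ⟨0, map_zero _⟩
  | add x y hx hy =>
    rw [map_add]
    obtain ⟨⟨a, ha⟩, b, hb⟩ := hx, hy
    exact ⟨a + b, by rw [map_add, ha, hb]⟩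

end CrossedProduct

/-! ### Duality -/

namespace CrossedProduct

variable {B : Type*} [CStarAlgebra B] {β : B ≃⋆ₐ[ℂ] B}

variable (β) in
/-- The unitary `v* u` of `B ⋊_β ℤ`. These are the unitaries that the dual action multiplies by
`ζ`, and `v* u` commutes with `B` exactly if `v` implements `β`. -/
def dualUnitary (v : unitary B) : unitary (CrossedProduct β) :=
  ⟨inclusion β (star v), Unitary.map_mem _ (Unitary.star_mem v.prop)⟩ * canonicalUnitary β

theorem coe_dualUnitary (v : unitary B) :
    (dualUnitary β v : CrossedProduct β) = inclusion β (star (v : B)) * canonicalUnitary β := rfl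

theorem dualAction_dualUnitary (ζ : Circle) (v : unitary B) :
    (dualAction β).toHom ζ (dualUnitary β v) =
      (ζ : ℂ) • (dualUnitary β v : CrossedProduct β) := by
  rw [coe_dualUnitary, map_mul, dualAction_inclusion, dualAction_canonicalUnitary, mul_smul_comm]

theorem canonicalUnitary_mul_inclusion (b : B) :
    canonicalUnitary β * inclusion β b = inclusion β (β b) * canonicalUnitary β := by
  rw [← conjStarAlgAut_canonicalUnitary, Unitary.conjStarAlgAut_apply, mul_assoc,
    Unitary.star_mul_self_of_mem (canonicalUnitary β).prop, mul_one]

theorem norm_inclusion (b : B) : ‖inclusion β b‖ = ‖b‖ :=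
  (isometry_inclusion β).norm_map_of_map_zero (map_zero _) b

theorem norm_conj_dualUnitary_inclusion_sub (v : unitary B) (b : B) :
    ‖Unitary.conjStarAlgAut ℂ _ (dualUnitary β v) (inclusion β b) - inclusion β b‖ =
      ‖Unitary.conjStarAlgAut ℂ B v b - β b‖ := by
  have h_comm : dualUnitary β v * inclusion β b - inclusion β b * dualUnitary β v =
      inclusion β (star (v : B) * β b - b * star (v : B)) * canonicalUnitary β := by
    rw [coe_dualUnitary, mul_assoc, canonicalUnitary_mul_inclusion]
    simp only [map_sub, map_mul, sub_mul, mul_assoc]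
  rw [norm_conjStarAlgAut_sub_self, h_comm, CStarRing.norm_mul_coe_unitary, norm_inclusion,
    ← CStarRing.norm_coe_unitary_mul v, mul_sub, ← mul_assoc,
    Unitary.mul_star_self_of_mem v.prop, one_mul, ← mul_assoc, norm_sub_rev,
    Unitary.conjStarAlgAut_apply]

theorem norm_conj_dualUnitary_canonicalUnitary_sub (v : unitary B) :
    ‖Unitary.conjStarAlgAut ℂ _ (dualUnitary β v) (canonicalUnitary β) - canonicalUnitary β‖ =
      ‖β v - v‖ := by
  have h_comm : (dualUnitary β v * canonicalUnitary β - canonicalUnitary β * dualUnitary β v :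
      CrossedProduct β) =
      inclusion β (star (v - β v)) * canonicalUnitary β * canonicalUnitary β := by
    rw [coe_dualUnitary, ← mul_assoc, canonicalUnitary_mul_inclusion, map_star β, star_sub, map_sub,
      sub_mul, sub_mul]
  rw [norm_conjStarAlgAut_sub_self, h_comm, CStarRing.norm_mul_coe_unitary,
    CStarRing.norm_mul_coe_unitary, norm_inclusion, norm_star, norm_sub_rev]

theorem norm_dualUnitary_sub (v : unitary B) (w : unitary (CrossedProduct β)) :
    ‖(dualUnitary β v - w : CrossedProduct β)‖ =
      ‖inclusion β v - (canonicalUnitary β * star w : unitary (CrossedProduct β))‖ := by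
  rw [← norm_star, ← CStarRing.norm_coe_unitary_mul (canonicalUnitary β), coe_dualUnitary, star_sub,
    star_mul, mul_sub, ← mul_assoc, Unitary.mul_star_self_of_mem (canonicalUnitary β).prop, one_mul,
    map_star, star_star]
  rfl

theorem norm_dualAction_canonicalUnitary_mul_star_sub (ζ : Circle)
    (w : unitary (CrossedProduct β)) :
    ‖(dualAction β).toHom ζ (canonicalUnitary β * star w : unitary (CrossedProduct β)) -
        (canonicalUnitary β * star w : unitary (CrossedProduct β))‖ =
      ‖(dualAction β).toHom ζ w - (ζ : ℂ) • (w : CrossedProduct β)‖ := by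
  have h_eq : (dualAction β).toHom ζ (canonicalUnitary β * star w : unitary (CrossedProduct β)) -
      (canonicalUnitary β * star w : unitary (CrossedProduct β)) =
      (ζ : ℂ) • (canonicalUnitary β *
        star ((dualAction β).toHom ζ w - (ζ : ℂ) • (w : CrossedProduct β))) := by
    rw [Submonoid.coe_mul, map_mul, dualAction_canonicalUnitary, Unitary.coe_star, map_star,
      star_sub, star_smul, mul_sub, smul_sub, smul_mul_assoc, mul_smul_comm, smul_smul]
    simp [Complex.mul_conj]
  rw [h_eq, norm_smul, Circle.norm_coe, one_mul, CStarRing.norm_coe_unitary_mul, norm_star]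

variable {ι : Type*} {l : Filter ι}

theorem tendsto_conj_dualUnitary_iff {v : ι → unitary B} :
    (∀ x, Tendsto (fun i => Unitary.conjStarAlgAut ℂ _ (dualUnitary β (v i)) x) l (𝓝 x)) ↔
      Tendsto (fun i => (β (v i) - v i : B)) l (𝓝 0) ∧
        ∀ b, Tendsto (fun i => Unitary.conjStarAlgAut ℂ B (v i) b) l (𝓝 (β b)) := by
  have h_unitary : Tendsto (fun i => Unitary.conjStarAlgAut ℂ _ (dualUnitary β (v i))
      (canonicalUnitary β)) l (𝓝 (canonicalUnitary β : CrossedProduct β)) ↔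
      Tendsto (fun i => (β (v i) - v i : B)) l (𝓝 0) := by
    rw [tendsto_iff_norm_sub_tendsto_zero]
    simp only [norm_conj_dualUnitary_canonicalUnitary_sub]
    exact tendsto_zero_iff_norm_tendsto_zero.symm
  have h_inclusion (b : B) : Tendsto (fun i => Unitary.conjStarAlgAut ℂ _ (dualUnitary β (v i))
      (inclusion β b)) l (𝓝 (inclusion β b)) ↔
      Tendsto (fun i => Unitary.conjStarAlgAut ℂ B (v i) b) l (𝓝 (β b)) := by
    rw [tendsto_iff_norm_sub_tendsto_zero]
    simp only [norm_conj_dualUnitary_inclusion_sub]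
    exact tendsto_iff_norm_sub_tendsto_zero.symm
  refine ⟨fun h => ⟨h_unitary.mp (h _), fun b => (h_inclusion b).mp (h _)⟩, fun h x => ?_⟩
  have h_top := starSubalgebra_eq_top (isClosed_tendstoStarSubalgebra (l := l)
    (fun i => (Unitary.conjStarAlgAut ℂ _ (dualUnitary β (v i)) :
      CrossedProduct β →⋆ₐ[ℂ] CrossedProduct β)) (.id ℂ _))
    (fun b => (h_inclusion b).mpr (h.2 b)) (h_unitary.mpr h.1)
  exact h_top.ge (Set.mem_univ x)

theorem exists_tendsto_dualUnitary_sub {w : ι → unitary (CrossedProduct β)}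
    (h : TendstoUniformly
      (fun i ζ => (dualAction β).toHom ζ (w i) - (ζ : ℂ) • (w i : CrossedProduct β)) 0 l) :
    ∃ v : ι → unitary B,
      Tendsto (fun i => (dualUnitary β (v i) - w i : CrossedProduct β)) l (𝓝 0) := by
  set x : ι → unitary (CrossedProduct β) := fun i => canonicalUnitary β * star (w i) with hx
  have h_fixed : TendstoUniformly
      (fun i ζ => (dualAction β).toHom ζ (x i) - x i : ι → Circle → CrossedProduct β) 0 l := by
    simpa only [Metric.tendstoUniformly_iff, Pi.zero_apply, dist_zero_left, hx,
      norm_dualAction_canonicalUnitary_mul_star_sub] using h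
  choose c hc using fun i => expectation_mem_range_inclusion (x i : CrossedProduct β)
  have h_sub : Tendsto (fun i => inclusion β (c i) - x i) l (𝓝 0) := by
    simpa only [hc] using CircleAction.tendsto_expectation_sub h_fixed
  obtain ⟨v, hv⟩ := exists_unitary_tendsto_map_sub (isometry_inclusion β) h_sub
  refine ⟨v, ?_⟩
  rw [tendsto_zero_iff_norm_tendsto_zero] at hv ⊢
  simpa only [norm_dualUnitary_sub] using hv

end CrossedProduct

theorem mainTheorem9 {B : Type*} [CStarAlgebra B] [Nontrivial B]
    [TopologicalSpace.SeparableSpace B] (β : B ≃⋆ₐ[ℂ] B) :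
    IsApproxRepresentable β ↔ (dualAction β).HasRokhlinProperty := by
  rw [isApproxRepresentable_iff_exists_seq]
  constructor
  · rintro ⟨v, hv⟩
    refine CircleAction.hasRokhlinProperty_of_tendsto (dualAction β)
      (w := fun n => CrossedProduct.dualUnitary β (v n)) ?_
      (CrossedProduct.tendsto_conj_dualUnitary_iff.mpr hv)
    simp only [CrossedProduct.dualAction_dualUnitary, sub_self]
    exact fun u hu => .of_forall fun _ _ => refl_mem_uniformity hu
  · intro h
    obtain ⟨w, h_eigen, h_conj⟩ := h.exists_seq
    obtain ⟨v, hv⟩ := CrossedProduct.exists_tendsto_dualUnitary_sub h_eigen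
    exact ⟨v, CrossedProduct.tendsto_conj_dualUnitary_iff.mp fun x =>
      tendsto_conjStarAlgAut_of_tendsto_sub hv (h_conj x)⟩
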